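/- Let $\mathfrak g$ be a finite-dimensional nilpotent real Lie algebra. **(1)** Let $\alpha,\beta$ be derivations of $\mathfrak g$ that are diagonalizable over $\mathbb R$ with all eigenvalues strictly positive. For such a derivation $\delta$, the *Heintze group defined by $\delta$* is the simply connected real Lie group whose Lie algebra is (isomorphic to) the semidirect product $\mathfrak g\rtimes_\delta\mathbb R$, i.e. $\mathfrak g\times\mathbb R$ with bracket $[(x,s),(y,t)]=([x,y]+s\,\delta y-t\,\delta x,\,0)$; and the *$\mathbb R$-grading defined by $\delta$* is $\mathfrak g=\bigoplus_{w\in\mathbb R}V_w$ with $V_w=\{x\in\mathfrak g:\delta x=wx\}$. If $\alpha$ and $\beta$ define isomorphic Heintze groups (isomorphic as Lie groups), then the $\mathbb R$-gradings $\mathfrak g=\bigoplus_w V_w$ and $\mathfrak g=\bigoplus_w W_w$ they define are equivalent: there are a Lie algebra automorphism $\Phi$ of $\mathfrak g$ and an isomorphism of abelian groups $f:\mathbb R\to\mathbb R$ such that $W_{f(w)}=\Phi(V_w)$ for all $w\in\mathbb R$. **(2)** Let $\delta$ be a derivation of $\mathfrak g$ that is diagonalizable over $\mathbb R$ with all eigenvalues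 strictly positive. Then for every $Y\in\mathfrak g$ there is an $X\in\mathfrak g$ with $$\operatorname{Ad}_{\exp(X)}\circ\delta\circ\operatorname{Ad}_{\exp(-X)}=\delta-\operatorname{ad}_Y,\qquad\text{where }\operatorname{Ad}_{\exp(X)}=e^{\operatorname{ad}_X}.$$ -/

import Mathlib

open scoped Manifold ContDiff

noncomputable section

namespace Heintze

/-! ### Gradings of Lie algebras, push-forwards and equivalence -/

section Gradings

/-- A grading of the Lie algebra `𝔤` over the abelian group `A`: a direct sum decomposition
`𝔤 = ⨁ a, V a` into subspaces with `⁅V a, V b⁆ ⊆ V (a + b)`. -/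
@[ext] structure Grading (K : Type*) [Field K] (A : Type*) [AddCommGroup A]
    (𝔤 : Type*) [LieRing 𝔤] [LieAlgebra K 𝔤] where
  /-- The layers `V a`. -/
  layer : A → Submodule K 𝔤
  indep : iSupIndep layer
  iSup_eq_top : ⨆ a, layer a = ⊤
  lie_mem : ∀ (a b : A) (x y : 𝔤), x ∈ layer a → y ∈ layer b → ⁅x, y⁆ ∈ layer (a + b)

variable {K : Type*} [Field K] {A B : Type*} [AddCommGroup A] [AddCommGroup B]
  {𝔤 : Type*} [LieRing 𝔤] [LieAlgebra K 𝔤]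

/-- The push-forward grading `f_* Φ(V)` over `B`, with layers `W b = ⨁_{f a = b} Φ (V a)`. -/
def Grading.pushforward (f : A →+ B) (Φ : 𝔤 ≃ₗ⁅K⁆ 𝔤) (V : Grading K A 𝔤) : Grading K B 𝔤 where
  layer b := ⨆ a ∈ {a : A | f a = b}, (V.layer a).map (Φ.toLinearEquiv : 𝔤 →ₗ[K] 𝔤)
  indep := by
    have h : iSupIndep fun a => (V.layer a).map (Φ.toLinearEquiv : 𝔤 →ₗ[K] 𝔤) :=
      V.indep.map_orderIso (Submodule.orderIsoMapComap Φ.toLinearEquiv)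
    intro b
    refine Disjoint.mono_right ?_ (h.disjoint_biSup_biSup (s := {a | f a = b})
      (t := {a | f a ≠ b}) ?_)
    · refine iSup₂_le fun b' hb' => iSup₂_le fun a ha => ?_
      have ha' : a ∈ {a | f a ≠ b} := by
        intro hab
        exact hb' (ha.symm.trans hab)
      exact le_iSup₂_of_le a ha' le_rfl
    · rw [Set.disjoint_left]
      intro a h1 h2
      exact h2 h1
  iSup_eq_top := by
    rw [eq_top_iff]
    have h : (⊤ : Submodule K 𝔤) = (⨆ a, V.layer a).map (Φ.toLinearEquiv : 𝔤 →ₗ[K] 𝔤) := by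
      rw [V.iSup_eq_top, Submodule.map_top, LinearEquiv.range]
    rw [h, Submodule.map_iSup]
    exact iSup_le fun a => le_iSup_of_le (f a) (le_iSup₂_of_le a rfl le_rfl)
  lie_mem := by
    intro b c x y hx hy
    induction hx using Submodule.iSup_induction' with
    | zero => simp
    | add x x' _ _ h h' => rw [add_lie]; exact Submodule.add_mem _ h h'
    | mem a x hx =>
      induction hx using Submodule.iSup_induction' with
      | zero => simp
      | add x x' _ _ h h' => rw [add_lie]; exact Submodule.add_mem _ h h'
      | mem ha x hx =>
        induction hy using Submodule.iSup_induction' with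
        | zero => simp
        | add y y' _ _ h h' => rw [lie_add]; exact Submodule.add_mem _ h h'
        | mem a' y hy =>
          induction hy using Submodule.iSup_induction' with
          | zero => simp
          | add y y' _ _ h h' => rw [lie_add]; exact Submodule.add_mem _ h h'
          | mem ha' y hy =>
            obtain ⟨u, hu, rfl⟩ := hx
            obtain ⟨v, hv, rfl⟩ := hy
            have hm : a + a' ∈ {d : A | f d = b + c} := by
              have h1 : f a = b := ha
              have h2 : f a' = c := ha'
              change f (a + a') = b + c
              rw [map_add, h1, h2]
            refine Submodule.mem_iSup_of_mem (a + a') (Submodule.mem_iSup_of_mem hm ?_)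
            exact ⟨⁅u, v⁆, V.lie_mem a a' u v hu hv, Φ.map_lie u v⟩

/-- Equivalence of an `A`-grading `V` and a `B`-grading `W`: `W = f_* Φ(V)` for some
automorphism `Φ` of the Lie algebra and some isomorphism of abelian groups `f : A ≃+ B`. -/
def Grading.Equivalent (V : Grading K A 𝔤) (W : Grading K B 𝔤) : Prop :=
  ∃ (Φ : 𝔤 ≃ₗ⁅K⁆ 𝔤) (f : A ≃+ B), W = V.pushforward f.toAddMonoidHom Φ

end Gradings

/-! ### Diagonalizable derivations and the gradings they induce -/

section Derivations

variable {𝔤 : Type*} [LieRing 𝔤] [LieAlgebra ℝ 𝔤]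

/-- The derivation `δ` is diagonalizable (over `ℝ`): there is a basis consisting of eigenvectors. -/
def IsDiagonalizable (δ : LieDerivation ℝ 𝔤 𝔤) : Prop :=
  ∃ (n : ℕ) (b : Module.Basis (Fin n) ℝ 𝔤) (w : Fin n → ℝ), ∀ i, δ (b i) = w i • b i

/-- All eigenvalues of the derivation `δ` are strictly positive. -/
def PositiveEigenvalues (δ : LieDerivation ℝ 𝔤 𝔤) : Prop :=
  ∀ w : ℝ, Module.End.HasEigenvalue (δ : 𝔤 →ₗ[ℝ] 𝔤) w → 0 < w

/-- The `ℝ`-grading induced by a diagonalizable derivation `δ`: the layer of weight `w` is the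
eigenspace `{x | δ x = w x}`. -/
def inducedGrading (δ : LieDerivation ℝ 𝔤 𝔤) (hδ : IsDiagonalizable δ) : Grading ℝ ℝ 𝔤 where
  layer w := Module.End.eigenspace (δ : 𝔤 →ₗ[ℝ] 𝔤) w
  indep := Module.End.eigenspaces_iSupIndep _
  iSup_eq_top := by
    obtain ⟨n, b, w, hb⟩ := hδ
    rw [eq_top_iff, ← b.span_eq, Submodule.span_le]
    rintro _ ⟨i, rfl⟩
    exact Submodule.mem_iSup_of_mem (w i) (Module.End.mem_eigenspace_iff.mpr (hb i))
  lie_mem := by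
    intro a b x y hx hy
    rw [Module.End.mem_eigenspace_iff] at hx hy ⊢
    change δ x = a • x at hx
    change δ y = b • y at hy
    change δ ⁅x, y⁆ = (a + b) • ⁅x, y⁆
    rw [LieDerivation.apply_lie_eq_add, hx, hy, lie_smul, smul_lie, add_smul, add_comm]

/-- The exponential series `∑ i, N ^ i / i!` of a nilpotent endomorphism `N`, which stops at the
nilpotency class of `N` (the least `k` with `N ^ k = 0`). -/
def nilpotentExp (N : Module.End ℝ 𝔤) : Module.End ℝ 𝔤 :=
  ∑ i ∈ Finset.range (nilpotencyClass N), ((i.factorial : ℝ)⁻¹) • N ^ i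

/-- `Ad_{exp X} = e^{ad X}`, for an element `X` of a nilpotent real Lie algebra. -/
def AdExp (X : 𝔤) : Module.End ℝ 𝔤 :=
  nilpotentExp (LieAlgebra.ad ℝ 𝔤 X)

end Derivations

/-! ### Heintze groups -/

section Groups

variable {𝔤 : Type*} [LieRing 𝔤] [LieAlgebra ℝ 𝔤]

/-- The line `ℝ` as a Lie algebra, with the commutator bracket `⁅s, t⁆ = s * t - t * s = 0`. -/
instance realLieRing : LieRing ℝ := LieRing.ofAssociativeRing

instance realLieAlgebra : LieAlgebra ℝ ℝ := LieAlgebra.ofAssociativeAlgebra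

/-- The action of the abelian Lie algebra `ℝ` on `𝔤` by `t ↦ t • δ`. -/
def lineAction (δ : LieDerivation ℝ 𝔤 𝔤) : ℝ →ₗ⁅ℝ⁆ LieDerivation ℝ 𝔤 𝔤 where
  toFun t := t • δ
  map_add' s t := add_smul s t δ
  map_smul' s t := mul_smul s t δ
  map_lie' := by
    intro s t
    simp [Ring.lie_def, mul_comm s t]

/-- The semidirect product `𝔤 ⋊_δ ℝ`: the vector space `𝔤 × ℝ` with the bracket
`⁅(x, s), (y, t)⁆ = (⁅x, y⁆ + s • δ y - t • δ x, 0)`. -/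
abbrev SemidirectLine (δ : LieDerivation ℝ 𝔤 𝔤) : Type _ :=
  LieAlgebra.SemiDirectSum 𝔤 ℝ (lineAction δ)

/-- A smooth real Lie group is a `C^3` Lie group, so that Mathlib's Lie algebra structure on
its tangent space at the identity applies. -/
instance lieGroup_minSmoothness {n : ℕ} {G : Type*} [TopologicalSpace G]
    [ChartedSpace (EuclideanSpace ℝ (Fin n)) G] [Group G] [LieGroup (𝓡 n) ∞ G] :
    LieGroup (𝓡 n) (minSmoothness ℝ 3) G :=
  LieGroup.of_le (n := ∞) (by
    rw [minSmoothness_of_isRCLikeNormedField]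
    exact WithTop.coe_le_coe.mpr le_top)

/-- `G` is the Heintze group defined by `δ`: a simply connected (smooth, real, finite-dimensional)
Lie group whose Lie algebra is isomorphic to the semidirect product `𝔤 ⋊_δ ℝ`.
(It is used only for nilpotent `𝔤` and for `δ` with positive eigenvalues.) -/
structure IsHeintzeGroup (δ : LieDerivation ℝ 𝔤 𝔤) (n : ℕ) (G : Type*) [TopologicalSpace G]
    [ChartedSpace (EuclideanSpace ℝ (Fin n)) G] [Group G] [LieGroup (𝓡 n) ∞ G] : Prop where
  simplyConnected : SimplyConnectedSpace G
  lieAlgebra : Nonempty (GroupLieAlgebra (𝓡 n) G ≃ₗ⁅ℝ⁆ SemidirectLine δ)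

/-- Isomorphism of Lie groups: a group isomorphism that is smooth in both directions. -/
def LieGroupIsomorphic (n m : ℕ)
    (G : Type*) [TopologicalSpace G] [ChartedSpace (EuclideanSpace ℝ (Fin n)) G] [Group G]
    (H : Type*) [TopologicalSpace H] [ChartedSpace (EuclideanSpace ℝ (Fin m)) H] [Group H] :
    Prop :=
  ∃ φ : G ≃* H, ContMDiff (𝓡 n) (𝓡 m) ∞ φ ∧ ContMDiff (𝓡 m) (𝓡 n) ∞ φ.symm

end Groups

end Heintze

end

/-!
Both parts rest on the formula
`Ad_{exp X} ∘ δ ∘ Ad_{exp (-X)} = e ^ {ad (ad X)} δ = δ - ad (F X)`, where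
`F X = ∑ i, (ad X) ^ i (δ X) / (i + 1)!` (`Heintze.AdExp_conj`). It reduces the second part to the
surjectivity of `F` (`Heintze.conjShift_surjective`). On the `k`-th term of the lower central
series, `F` differs from the linear map `δ` only by terms that are one step deeper, and `δ` is
invertible on every term of the series; so `F X = Y` is solved by successive approximation, which
stops because `𝔤` is nilpotent.

For the first part, the differential at the identity of an isomorphism of the Heintze groups is an
isomorphism of their Lie algebras (`Heintze.nonempty_groupLieAlgebra_equiv`), so that
`𝔤 ⋊_α ℝ ≅ 𝔤 ⋊_β ℝ`. Since `α` and `β` are invertible, `𝔤` is the derived subalgebra on both sides;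
hence the isomorphism restricts to an automorphism `φ` of `𝔤`, and if it sends `(0, 1)` to `(Y, c)`
then `c ≠ 0` and `φ α φ⁻¹ = c β + ad Y = c (β + ad (c⁻¹ Y))`. By the second part, `β + ad (c⁻¹ Y)`
is conjugate to `β` under some `Ad_{exp X}`. Composing `φ` with the inverse of that automorphism
gives an automorphism that carries `α` to `c β`, hence the eigenspace of `α` for `w` to the
eigenspace of `β` for `c⁻¹ w`.
-/

namespace Heintze

/-! ### The differential of a Lie group isomorphism -/

section Differential

open VectorField

variable {𝕜 : Type*} [NontriviallyNormedField 𝕜]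
  {E : Type*} [NormedAddCommGroup E] [NormedSpace 𝕜 E]
  {E' : Type*} [NormedAddCommGroup E'] [NormedSpace 𝕜 E']
  {M : Type*} [TopologicalSpace M] {I : ModelWithCorners 𝕜 E M}
  {M' : Type*} [TopologicalSpace M'] {I' : ModelWithCorners 𝕜 E' M'}
  {G : Type*} [TopologicalSpace G] [ChartedSpace M G]
  {H : Type*} [TopologicalSpace H] [ChartedSpace M' H]

lemma mfderiv_comp_mfderiv_symm {φ : G ≃ H} (hφ : MDifferentiable I I' φ)
    (hψ : MDifferentiable I' I φ.symm) {g : G} {h : H} (hgh : φ g = h) :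
    (mfderiv I I' φ g : E →L[𝕜] E').comp (mfderiv I' I φ.symm h : E' →L[𝕜] E) =
      ContinuousLinearMap.id 𝕜 E' := by
  obtain rfl : φ.symm h = g := by simp [← hgh]
  have := mfderiv_comp h (hφ _) (hψ h)
  rw [Equiv.self_comp_symm, mfderiv_id] at this
  exact this.symm

variable [Group G] [Group H]

/-- The differential at the identity of a diffeomorphic group isomorphism, as a linear
equivalence of the tangent spaces at the identities. The tangent space at `φ 1` is identified with
the one at `1` through the model space `E'`. -/
noncomputable def differential (φ : G ≃* H) (hφ : MDifferentiable I I' φ)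
    (hψ : MDifferentiable I' I φ.symm) : GroupLieAlgebra I G ≃ₗ[𝕜] GroupLieAlgebra I' H :=
  LinearEquiv.ofLinearMap (M := E) (M₂ := E')
    (ContinuousLinearMap.toLinearMap (M := E) (M₂ := E') (mfderiv I I' φ 1))
    (ContinuousLinearMap.toLinearMap (M := E') (M₂ := E) (mfderiv I' I φ.symm 1))
    (congrArg ContinuousLinearMap.toLinearMap
      (mfderiv_comp_mfderiv_symm (φ := φ.toEquiv) hφ hψ (map_one φ)))
    (congrArg ContinuousLinearMap.toLinearMap
      (mfderiv_comp_mfderiv_symm (φ := φ.symm.toEquiv) hψ hφ (map_one φ.symm)))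

variable [LieGroup I (minSmoothness 𝕜 3) G] [LieGroup I' (minSmoothness 𝕜 3) H]

/-- A smooth isomorphism of Lie groups pulls left invariant vector fields back to left invariant
vector fields. -/
lemma mpullback_mulInvariantVectorField_differential (φ : G ≃* H) (hφ : MDifferentiable I I' φ)
    (hψ : MDifferentiable I' I φ.symm) (v : GroupLieAlgebra I G) :
    mpullback I I' φ (mulInvariantVectorField (differential φ hφ hψ v)) =
      mulInvariantVectorField v := by
  have M : minSmoothness 𝕜 3 ≠ 0 := lt_of_lt_of_le (by simp) le_minSmoothness |>.ne'
  ext g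
  have hinv : (mfderiv I I' φ g : E →L[𝕜] E').IsInvertible :=
    .of_inverse (mfderiv_comp_mfderiv_symm (φ := φ.toEquiv) hφ hψ rfl)
      (mfderiv_comp_mfderiv_symm (φ := φ.symm.toEquiv) hψ hφ (φ.symm_apply_apply g))
  refine hinv.inverse_apply_eq.2 ?_
  have h1 : (φ : G → H) ∘ (g * ·) = (φ g * ·) ∘ φ := by ext x; simp
  have hG : MDifferentiable I I (g * · : G → G) := contMDiff_mul_left.mdifferentiable M
  have hH : MDifferentiable I' I' (φ g * · : H → H) := contMDiff_mul_left.mdifferentiable M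
  have h2 := mfderiv_comp (1 : G) (hφ (g * 1)) (hG 1)
  have h3 := mfderiv_comp (1 : G) (hH (φ 1)) (hφ 1)
  rw [h1] at h2
  have h4 := DFunLike.congr_fun (h3.symm.trans h2) v
  -- `φ 1` and `g * 1` equal `1` and `g` only propositionally, so the derivatives at these points
  -- are compared as maps between the model spaces.
  have e1 : ∀ (h : H) (w : E'), h = 1 → (mfderiv I' I' (φ g * · : H → H) h : E' →L[𝕜] E') w =
      (mfderiv I' I' (φ g * · : H → H) 1 : E' →L[𝕜] E') w := by
    rintro _ w rfl; rfl
  have e2 : ∀ (x : G) (w : E), x = g → (mfderiv I I' φ x : E →L[𝕜] E') w =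
      (mfderiv I I' φ g : E →L[𝕜] E') w := by
    rintro _ w rfl; rfl
  exact (e1 _ _ (map_one φ)).symm.trans (h4.trans (e2 _ _ (mul_one g)))

/-- A smooth isomorphism of Lie groups induces an isomorphism of their Lie algebras. -/
theorem nonempty_groupLieAlgebra_equiv [CompleteSpace E] [CompleteSpace E'] (φ : G ≃* H)
    (hφ : ContMDiff I I' (minSmoothness 𝕜 3) φ)
    (hψ : ContMDiff I' I (minSmoothness 𝕜 3) φ.symm) :
    Nonempty (GroupLieAlgebra I G ≃ₗ⁅𝕜⁆ GroupLieAlgebra I' H) := by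
  have M : minSmoothness 𝕜 3 ≠ 0 := lt_of_lt_of_le (by simp) le_minSmoothness |>.ne'
  have hφ' := hφ.mdifferentiable M
  have hψ' := hψ.mdifferentiable M
  let d := differential φ hφ' hψ'
  have key : ∀ v w : GroupLieAlgebra I G, d ⁅v, w⁆ = ⁅d v, d w⁆ := by
    intro v w
    have h := mpullback_mlieBracket (x₀ := (1 : G)) (n := minSmoothness 𝕜 3)
      (mdifferentiableAt_mulInvariantVectorField (I := I') (d v) (g := φ 1))
      (mdifferentiableAt_mulInvariantVectorField (I := I') (d w) (g := φ 1))
      hφ.contMDiffAt (minSmoothness_monotone (by norm_cast))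
    rw [mpullback_mulInvariantVectorField_differential,
      mpullback_mulInvariantVectorField_differential] at h
    have hinv : (mfderiv I I' φ 1 : E →L[𝕜] E').IsInvertible :=
      .of_inverse (mfderiv_comp_mfderiv_symm (φ := φ.toEquiv) hφ' hψ' rfl)
        (mfderiv_comp_mfderiv_symm (φ := φ.symm.toEquiv) hψ' hφ' (φ.symm_apply_apply 1))
    -- `φ 1 = 1` is not definitional; the values of the bracket are compared in the model space.
    have e : ∀ x : H, x = 1 →
        (mlieBracket I' (mulInvariantVectorField (d v)) (mulInvariantVectorField (d w)) x : E') =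
        (mlieBracket I' (mulInvariantVectorField (d v)) (mulInvariantVectorField (d w)) 1 : E') := by
      rintro _ rfl; rfl
    exact (hinv.inverse_apply_eq.1 h).symm.trans (e _ (map_one φ))
  exact ⟨{ d with map_lie' := key _ _ }⟩

end Differential

/-! ### Conjugation by the exponential of a nilpotent endomorphism -/

section Exponential

open Finset IsNilpotent LinearMap

/-- The identity `Ad (exp a) = exp (ad a)` for a nilpotent `a`, the second exponential being
evaluated at `d`; here `ad a` is written as left minus right multiplication by `a`. -/
lemma exp_mul_mul_exp_neg {R A : Type*} [CommRing R] [Ring A] [Algebra R A] [Module ℚ A]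
    {a d : A} (ha : IsNilpotent a) {k : ℕ} (hk : ((mulLeft R a - mulRight R a) ^ k) d = 0) :
    IsNilpotent.exp a * d * IsNilpotent.exp (-a) =
      ∑ i ∈ range k, (i.factorial : ℚ)⁻¹ • ((mulLeft R a - mulRight R a) ^ i) d := by
  have hl : IsNilpotent (mulLeft R a) := (isNilpotent_mulLeft_iff R a).2 ha
  have hr : IsNilpotent (mulRight R a) := (isNilpotent_mulRight_iff R a).2 ha
  have hcomm : Commute (mulLeft R a) (mulRight R a) := commute_mulLeft_right a a
  have hn : IsNilpotent (mulLeft R a - mulRight R a) := hcomm.isNilpotent_sub hl hr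
  have h1 : IsNilpotent.exp (mulLeft R a) = mulLeft R (IsNilpotent.exp a) :=
    (map_exp ha (Algebra.lmul R A)).symm
  have h2 : IsNilpotent.exp (-mulRight R a) = mulRight R (IsNilpotent.exp (-a)) := by
    obtain ⟨m, hm⟩ := ha.neg
    have hneg : -mulRight R a = mulRight R (-a) := by ext; simp
    have hm' : mulRight R (-a) ^ m = 0 := by rw [pow_mulRight, hm]; simp
    rw [hneg, exp_eq_sum hm, exp_eq_sum hm']
    ext x
    simpa [Finset.mul_sum] using Finset.sum_congr rfl fun i _ =>
      (map_rat_smul (AddMonoidHom.mulLeft x) (i.factorial : ℚ)⁻¹ ((-a) ^ i)).symm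
  have h3 := exp_smul_eq_sum (M := A) (a := mulLeft R a - mulRight R a) (m := d) hk hn
  have h4 : IsNilpotent.exp (mulLeft R a - mulRight R a) =
      mulLeft R (IsNilpotent.exp a) * mulRight R (IsNilpotent.exp (-a)) := by
    rw [sub_eq_add_neg, exp_add_of_commute hcomm.neg_right hl hr.neg, h1, h2]
  rw [h4] at h3
  simpa [mul_assoc] using h3

end Exponential

section Algebra

variable {𝔤 : Type*} [LieRing 𝔤] [LieAlgebra ℝ 𝔤]

lemma nilpotentExp_eq_exp [Module ℚ 𝔤] (N : Module.End ℝ 𝔤) :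
    nilpotentExp N = IsNilpotent.exp N := by
  refine Finset.sum_congr rfl fun i _ => ?_
  rw [← Rat.cast_smul_eq_qsmul ℝ]
  simp

/-- The rational structure underlying a real Lie algebra. -/
noncomputable abbrev ratLieAlgebra (𝔤 : Type*) [LieRing 𝔤] [LieAlgebra ℝ 𝔤] : LieAlgebra ℚ 𝔤 where
  __ := Module.compHom 𝔤 (algebraMap ℚ ℝ)
  lie_smul q x y := lie_smul (q : ℝ) x y

lemma isNilpotent_ad [LieRing.IsNilpotent 𝔤] (X : 𝔤) : IsNilpotent (LieAlgebra.ad ℝ 𝔤 X) :=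
  LieModule.isNilpotent_toEnd_of_isNilpotent ℝ 𝔤 𝔤 X

lemma AdExp_neg_mul_AdExp [LieRing.IsNilpotent 𝔤] (X : 𝔤) : AdExp (-X) * AdExp X = 1 := by
  let _ := ratLieAlgebra 𝔤
  rw [AdExp, AdExp, nilpotentExp_eq_exp, nilpotentExp_eq_exp, map_neg]
  exact IsNilpotent.exp_neg_mul_exp_self (isNilpotent_ad X)

/-- `Ad_{exp X}` as an automorphism of the Lie algebra. -/
lemma exists_lieEquiv_eq_AdExp [LieRing.IsNilpotent 𝔤] (X : 𝔤) :
    ∃ e : 𝔤 ≃ₗ⁅ℝ⁆ 𝔤, ∀ x, e x = AdExp X x := by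
  let _ := ratLieAlgebra 𝔤
  have hX : (LieDerivation.ad ℝ 𝔤 X).toLinearMap = LieAlgebra.ad ℝ 𝔤 X := by ext; simp
  refine ⟨LieDerivation.exp (LieDerivation.ad ℝ 𝔤 X) (hX ▸ isNilpotent_ad X), fun x => ?_⟩
  rw [AdExp, nilpotentExp_eq_exp, LieDerivation.exp_map_apply, hX]

/-! ### The derivations conjugate to `δ` under `Ad_{exp X}` -/

lemma ad_ad_pow_succ_derivation (δ : LieDerivation ℝ 𝔤 𝔤) (X : 𝔤) (i : ℕ) :
    ((LinearMap.mulLeft ℝ (LieAlgebra.ad ℝ 𝔤 X) - LinearMap.mulRight ℝ (LieAlgebra.ad ℝ 𝔤 X)) ^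
      (i + 1)) (δ : Module.End ℝ 𝔤) =
      -LieAlgebra.ad ℝ 𝔤 ((LieAlgebra.ad ℝ 𝔤 X ^ i) (δ X)) := by
  induction i with
  | zero =>
    ext y
    simp
  | succ i ih =>
    rw [pow_succ', Module.End.mul_apply, ih, pow_succ' _ i, Module.End.mul_apply]
    ext y
    simp only [LinearMap.sub_apply, LinearMap.mulLeft_apply, LinearMap.mulRight_apply,
      Module.End.mul_apply, LinearMap.neg_apply, LieAlgebra.ad_apply, lie_lie, lie_neg]
    abel

/-- The element `((e ^ {ad X} - 1) / ad X) (δ X)` of `𝔤`, the series being cut off after the term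
of index `n`. Conjugation by `Ad_{exp X}` subtracts its adjoint endomorphism from `δ`. -/
noncomputable def conjShift (δ : LieDerivation ℝ 𝔤 𝔤) (n : ℕ) (X : 𝔤) : 𝔤 :=
  ∑ i ∈ Finset.range (n + 1), ((i + 1).factorial : ℝ)⁻¹ • (LieAlgebra.ad ℝ 𝔤 X ^ i) (δ X)

lemma AdExp_conj [LieRing.IsNilpotent 𝔤] (δ : LieDerivation ℝ 𝔤 𝔤) {n : ℕ}
    (hn : LieModule.lowerCentralSeries ℝ 𝔤 𝔤 n = ⊥) (X : 𝔤) :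
    AdExp X * (δ : Module.End ℝ 𝔤) * AdExp (-X) =
      (δ : Module.End ℝ 𝔤) - LieAlgebra.ad ℝ 𝔤 (conjShift δ n X) := by
  let _ := ratLieAlgebra 𝔤
  have h0 : (LieAlgebra.ad ℝ 𝔤 X ^ n) (δ X) = 0 := by
    have := LieModule.iterate_toEnd_mem_lowerCentralSeries ℝ 𝔤 𝔤 X (δ X) n
    rwa [hn, LieSubmodule.mem_bot, ← Module.End.pow_apply] at this
  have hk : ((LinearMap.mulLeft ℝ (LieAlgebra.ad ℝ 𝔤 X) -
      LinearMap.mulRight ℝ (LieAlgebra.ad ℝ 𝔤 X)) ^ (n + 1 + 1)) (δ : Module.End ℝ 𝔤) = 0 := by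
    rw [ad_ad_pow_succ_derivation, pow_succ', Module.End.mul_apply, h0]
    simp
  rw [AdExp, AdExp, nilpotentExp_eq_exp, nilpotentExp_eq_exp, map_neg,
    exp_mul_mul_exp_neg (isNilpotent_ad X) hk, Finset.sum_range_succ']
  simp only [ad_ad_pow_succ_derivation, conjShift, ← Rat.cast_smul_eq_qsmul ℝ, map_sum, map_smul,
    smul_neg, Finset.sum_neg_distrib]
  simp [sub_eq_neg_add]

lemma derivation_mem_lowerCentralSeries (δ : LieDerivation ℝ 𝔤 𝔤) (k : ℕ) {x : 𝔤}
    (hx : x ∈ LieModule.lowerCentralSeries ℝ 𝔤 𝔤 k) :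
    δ x ∈ LieModule.lowerCentralSeries ℝ 𝔤 𝔤 k := by
  induction k generalizing x with
  | zero => simp
  | succ k ih =>
    rw [LieModule.lowerCentralSeries_succ] at hx ⊢
    rw [← LieSubmodule.mem_toSubmodule, LieSubmodule.lieIdeal_oper_eq_linear_span'] at hx
    induction hx using Submodule.span_induction with
    | mem z hz =>
      obtain ⟨u, -, v, hv, rfl⟩ := hz
      rw [LieDerivation.apply_lie_eq_add]
      exact add_mem (LieSubmodule.lie_mem_lie (LieSubmodule.mem_top u) (ih hv))
        (LieSubmodule.lie_mem_lie (LieSubmodule.mem_top _) hv)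
    | zero => simp
    | add a b _ _ ha hb => rw [map_add]; exact add_mem ha hb
    | smul c a _ ha => rw [map_smul]; exact Submodule.smul_mem _ c ha

lemma PositiveEigenvalues.injective {δ : LieDerivation ℝ 𝔤 𝔤} (hδ : PositiveEigenvalues δ) :
    Function.Injective δ := by
  have h : ¬ Module.End.HasEigenvalue (δ : 𝔤 →ₗ[ℝ] 𝔤) 0 := fun h => lt_irrefl _ (hδ 0 h)
  rw [Module.End.hasEigenvalue_iff, not_not, Module.End.eigenspace_zero, LinearMap.ker_eq_bot] at h
  exact h

lemma exists_mem_lowerCentralSeries_derivation_eq [FiniteDimensional ℝ 𝔤]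
    {δ : LieDerivation ℝ 𝔤 𝔤} (hδ : Function.Injective δ) (k : ℕ) {z : 𝔤}
    (hz : z ∈ LieModule.lowerCentralSeries ℝ 𝔤 𝔤 k) :
    ∃ u ∈ LieModule.lowerCentralSeries ℝ 𝔤 𝔤 k, δ u = z := by
  let L : Submodule ℝ 𝔤 := (LieModule.lowerCentralSeries ℝ 𝔤 𝔤 k).toSubmodule
  let r : L →ₗ[ℝ] L := (δ : 𝔤 →ₗ[ℝ] 𝔤).restrict
    fun x hx => derivation_mem_lowerCentralSeries δ k hx
  have hr : Function.Injective r := fun a b hab => Subtype.ext (hδ (congrArg Subtype.val hab))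
  obtain ⟨u, hu⟩ := LinearMap.surjective_of_injective hr ⟨z, hz⟩
  exact ⟨u, u.2, congrArg Subtype.val hu⟩

/-- Elements of the `k`-th term of the lower central series are central modulo the next term;
hence adding such a `U` to `X` changes `conjShift δ n X` only by `δ U` modulo the next term. -/
lemma conjShift_add_sub_mem (δ : LieDerivation ℝ 𝔤 𝔤) (n k : ℕ) (X : 𝔤) {U : 𝔤}
    (hU : U ∈ LieModule.lowerCentralSeries ℝ 𝔤 𝔤 k) :
    conjShift δ n (X + U) - conjShift δ n X - δ U ∈
      LieModule.lowerCentralSeries ℝ 𝔤 𝔤 (k + 1) := by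
  set L := LieModule.lowerCentralSeries ℝ 𝔤 𝔤 with hL
  have hstep : ∀ a b : 𝔤, a - b ∈ L k → ⁅X + U, a⁆ - ⁅X, b⁆ ∈ L (k + 1) := by
    intro a b hab
    have h : ⁅X + U, a⁆ - ⁅X, b⁆ = ⁅X, a - b⁆ - ⁅a, U⁆ := by
      rw [add_lie, lie_sub, ← lie_skew a U]; abel
    rw [h, hL, LieModule.lowerCentralSeries_succ]
    exact sub_mem (LieSubmodule.lie_mem_lie (LieSubmodule.mem_top _) hab)
      (LieSubmodule.lie_mem_lie (LieSubmodule.mem_top _) hU)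
  have hsucc : ∀ i : ℕ, (LieAlgebra.ad ℝ 𝔤 (X + U) ^ i) (δ (X + U)) -
      (LieAlgebra.ad ℝ 𝔤 X ^ i) (δ X) ∈ L k := by
    intro i
    induction i with
    | zero => simpa using derivation_mem_lowerCentralSeries δ k hU
    | succ i ih =>
      rw [pow_succ', pow_succ']
      exact LieModule.antitone_lowerCentralSeries ℝ 𝔤 𝔤 k.le_succ (hstep _ _ ih)
  have h : conjShift δ n (X + U) - conjShift δ n X - δ U =
      ∑ i ∈ Finset.range n, ((i + 1 + 1).factorial : ℝ)⁻¹ •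
        ((LieAlgebra.ad ℝ 𝔤 (X + U) ^ (i + 1)) (δ (X + U)) -
          (LieAlgebra.ad ℝ 𝔤 X ^ (i + 1)) (δ X)) := by
    simp only [conjShift, Finset.sum_range_succ' _ n, smul_sub, Finset.sum_sub_distrib]
    simp only [zero_add, Nat.factorial_one, Nat.cast_one, inv_one, pow_zero, one_smul,
      Module.End.one_apply, map_add]
    abel
  rw [h]
  refine sum_mem fun i _ => SMulMemClass.smul_mem _ ?_
  rw [pow_succ', pow_succ']
  exact hstep _ _ (hsucc i)

/-- Successive approximation along the lower central series: an error in the `k`-th term is pushed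
into the next term by correcting `X` with its preimage under `δ`. -/
lemma conjShift_surjective [FiniteDimensional ℝ 𝔤] {δ : LieDerivation ℝ 𝔤 𝔤}
    (hδ : Function.Injective δ) {n : ℕ} (hn : LieModule.lowerCentralSeries ℝ 𝔤 𝔤 n = ⊥) :
    Function.Surjective (conjShift δ n) := by
  intro Y
  have happrox : ∀ k : ℕ, ∃ X : 𝔤,
      Y - conjShift δ n X ∈ LieModule.lowerCentralSeries ℝ 𝔤 𝔤 k := by
    intro k
    induction k with
    | zero => exact ⟨0, by simp⟩
    | succ k ih =>
      obtain ⟨X, hX⟩ := ih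
      obtain ⟨U, hU, hδU⟩ := exists_mem_lowerCentralSeries_derivation_eq hδ k hX
      refine ⟨X + U, ?_⟩
      have h : Y - conjShift δ n (X + U) =
          -(conjShift δ n (X + U) - conjShift δ n X - δ U) := by
        rw [hδU]; abel
      rw [h]
      exact neg_mem (conjShift_add_sub_mem δ n k X hU)
  obtain ⟨X, hX⟩ := happrox n
  rw [hn, LieSubmodule.mem_bot, sub_eq_zero] at hX
  exact ⟨X, hX.symm⟩

theorem exists_AdExp_conj_eq_sub_ad [FiniteDimensional ℝ 𝔤] [LieRing.IsNilpotent 𝔤]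
    {δ : LieDerivation ℝ 𝔤 𝔤} (hδ : Function.Injective δ) (Y : 𝔤) :
    ∃ X : 𝔤, AdExp X * (δ : Module.End ℝ 𝔤) * AdExp (-X) =
      (δ : Module.End ℝ 𝔤) - LieAlgebra.ad ℝ 𝔤 Y := by
  obtain ⟨n, hn⟩ := LieModule.IsNilpotent.nilpotent ℝ 𝔤 𝔤
  obtain ⟨X, rfl⟩ := conjShift_surjective hδ hn Y
  exact ⟨X, AdExp_conj δ hn X⟩

/-! ### Isomorphisms of semidirect products -/

open LieAlgebra.SemiDirectSum

lemma lineAction_apply (δ : LieDerivation ℝ 𝔤 𝔤) (t : ℝ) (x : 𝔤) :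
    lineAction δ t x = t • δ x := rfl

lemma lie_inr_one_inl (δ : LieDerivation ℝ 𝔤 𝔤) (x : 𝔤) :
    ⁅inr (lineAction δ) 1, inl (lineAction δ) x⁆ = inl (lineAction δ) (δ x) := by
  simp [lineAction_apply]

/-- When `α` is onto, `𝔤` is the derived subalgebra of `𝔤 ⋊_α ℝ`; this is why an isomorphism of
semidirect products preserves `𝔤`. -/
lemma right_map_inl_eq_zero {α β : LieDerivation ℝ 𝔤 𝔤} (hα : Function.Surjective α)
    (Ψ : SemidirectLine α →ₗ⁅ℝ⁆ SemidirectLine β) (x : 𝔤) :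
    (Ψ (inl (lineAction α) x)).right = 0 := by
  obtain ⟨y, rfl⟩ := hα x
  rw [← lie_inr_one_inl, LieHom.map_lie, lie_eq_mk]
  simp [Ring.lie_def, mul_comm]

lemma inl_left_of_right_eq_zero {α : LieDerivation ℝ 𝔤 𝔤} {p : SemidirectLine α}
    (hp : p.right = 0) : inl (lineAction α) p.left = p := by
  cases p
  simp_all

/-- An isomorphism `𝔤 ⋊_α ℝ ≅ 𝔤 ⋊_β ℝ` restricts to an automorphism of `𝔤` that carries `α` to
`c β + ad Y`, where `(Y, c)` is the image of `(0, 1)`. -/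
lemma exists_lieEquiv_of_semidirectLine_equiv {α β : LieDerivation ℝ 𝔤 𝔤}
    (hα : Function.Surjective α) (hβ : Function.Surjective β)
    (Ψ : SemidirectLine α ≃ₗ⁅ℝ⁆ SemidirectLine β) :
    ∃ (φ : 𝔤 ≃ₗ⁅ℝ⁆ 𝔤) (c : ℝ) (Y : 𝔤), c ≠ 0 ∧
      ∀ x, φ (α x) = c • β (φ x) + ⁅Y, φ x⁆ := by
  have h1 : ∀ x, (Ψ (inl (lineAction α) x)).right = 0 := right_map_inl_eq_zero hα Ψ.toLieHom
  have h2 : ∀ x, (Ψ.symm (inl (lineAction β) x)).right = 0 :=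
    right_map_inl_eq_zero hβ Ψ.symm.toLieHom
  let φ : 𝔤 ≃ₗ⁅ℝ⁆ 𝔤 :=
    { toFun := fun x => (Ψ (inl (lineAction α) x)).left
      map_add' := fun x y => by rw [map_add, map_add, add_eq_mk]
      map_smul' := fun t x => by rw [map_smul, map_smul, smul_eq_mk, RingHom.id_apply]
      map_lie' := fun {x y} => by
        rw [LieHom.map_lie, LieEquiv.map_lie, lie_eq_mk]
        simp only [h1, map_zero]
        simp
      invFun := fun x => (Ψ.symm (inl (lineAction β) x)).left
      left_inv := fun x => by
        simp only [inl_left_of_right_eq_zero (h1 x)]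
        simp
      right_inv := fun x => by
        simp only [inl_left_of_right_eq_zero (h2 x)]
        simp }
  have hφ : ∀ x, Ψ (inl (lineAction α) x) = inl (lineAction β) (φ x) :=
    fun x => (inl_left_of_right_eq_zero (h1 x)).symm
  refine ⟨φ, (Ψ (inr (lineAction α) 1)).right, (Ψ (inr (lineAction α) 1)).left, ?_, fun x => ?_⟩
  · intro hc
    -- Otherwise the image of `Ψ` lies in `𝔤`, since `(0, 1)` and `𝔤` span the domain.
    have hr : ∀ p : SemidirectLine α, (Ψ p).right = 0 := by
      intro p
      have hp : p = inl (lineAction α) p.left + p.right • inr (lineAction α) 1 := by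
        cases p
        simp
      rw [hp, map_add, map_smul, add_eq_mk, smul_eq_mk]
      simp only [h1, hc, smul_zero, add_zero]
    have h := hr (Ψ.symm (inr (lineAction β) 1))
    rw [LieEquiv.apply_symm_apply] at h
    exact one_ne_zero h
  · have h := congrArg (fun p => (Ψ p).left) (lie_inr_one_inl α x)
    simp only [LieEquiv.map_lie] at h
    rw [hφ, hφ, lie_eq_mk] at h
    simpa [lineAction_apply, add_comm] using h.symm

lemma inducedGrading_equivalent_of_intertwines {α β : LieDerivation ℝ 𝔤 𝔤}
    (hα : IsDiagonalizable α) (hβ : IsDiagonalizable β) (Φ : 𝔤 ≃ₗ⁅ℝ⁆ 𝔤) {c : ℝ} (hc : c ≠ 0)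
    (h : ∀ x, Φ (α x) = c • β (Φ x)) :
    (inducedGrading α hα).Equivalent (inducedGrading β hβ) := by
  refine ⟨Φ, (LinearEquiv.smulOfNeZero ℝ ℝ c⁻¹ (inv_ne_zero hc)).toAddEquiv, ?_⟩
  have hα' : ∀ w x, x ∈ (inducedGrading α hα).layer w ↔ α x = w • x :=
    fun w x => Module.End.mem_eigenspace_iff
  have hβ' : ∀ w x, x ∈ (inducedGrading β hβ).layer w ↔ β x = w • x :=
    fun w x => Module.End.mem_eigenspace_iff
  refine Grading.ext (funext fun b => le_antisymm (fun y hy => ?_) ?_)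
  · have hmem : c * b ∈ {a : ℝ |
        (LinearEquiv.smulOfNeZero ℝ ℝ c⁻¹ (inv_ne_zero hc)).toAddEquiv.toAddMonoidHom a = b} :=
      inv_mul_cancel_left₀ hc b
    refine Submodule.mem_iSup_of_mem (c * b) (Submodule.mem_iSup_of_mem hmem
      ⟨Φ.symm y, ?_, Φ.apply_symm_apply y⟩)
    rw [SetLike.mem_coe, hα']
    apply Φ.injective
    change Φ _ = Φ _
    rw [h, Φ.apply_symm_apply, map_smul, Φ.apply_symm_apply, (hβ' _ _).1 hy, mul_smul]
  · refine iSup₂_le fun a ha => ?_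
    rintro _ ⟨x, hx, rfl⟩
    rw [SetLike.mem_coe, hα'] at hx
    have ha' : c⁻¹ * a = b := ha
    rw [hβ', ← ha', mul_smul, eq_inv_smul_iff₀ hc]
    change c • β (Φ x) = a • Φ x
    rw [← h, hx, map_smul]

theorem inducedGrading_equivalent_of_semidirectLine_equiv [FiniteDimensional ℝ 𝔤]
    [LieRing.IsNilpotent 𝔤] {α β : LieDerivation ℝ 𝔤 𝔤}
    (hα : IsDiagonalizable α) (hβ : IsDiagonalizable β)
    (hα' : Function.Injective α) (hβ' : Function.Injective β)
    (Ψ : SemidirectLine α ≃ₗ⁅ℝ⁆ SemidirectLine β) :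
    (inducedGrading α hα).Equivalent (inducedGrading β hβ) := by
  obtain ⟨φ, c, Y, hc, hφ⟩ := exists_lieEquiv_of_semidirectLine_equiv
    (LinearMap.surjective_of_injective (f := (α : 𝔤 →ₗ[ℝ] 𝔤)) hα')
    (LinearMap.surjective_of_injective (f := (β : 𝔤 →ₗ[ℝ] 𝔤)) hβ') Ψ
  -- `φ` carries `α` to `c (β + ad (c⁻¹ Y))`, and `Ad_{exp X}` carries `β` to `β + ad (c⁻¹ Y)`.
  obtain ⟨X, hX⟩ := exists_AdExp_conj_eq_sub_ad hβ' (-(c⁻¹ • Y))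
  obtain ⟨e, he⟩ := exists_lieEquiv_eq_AdExp X
  have hX' : ∀ x, e (β x) = β (e x) + c⁻¹ • ⁅Y, e x⁆ := by
    intro x
    have h := congrArg (fun f => f (AdExp X x)) hX
    have hinv : AdExp (-X) (AdExp X x) = x := LinearMap.congr_fun (AdExp_neg_mul_AdExp X) x
    simp only [Module.End.mul_apply, hinv] at h
    rw [he, he]
    simpa using h
  refine inducedGrading_equivalent_of_intertwines hα hβ (φ.trans e.symm) hc fun x => ?_
  apply e.injective
  simp [hφ, hX', smul_smul, hc]

end Algebra

end Heintze

theorem mainTheorem4 {𝔤 : Type*} [LieRing 𝔤] [LieAlgebra ℝ 𝔤] [FiniteDimensional ℝ 𝔤]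
    [LieRing.IsNilpotent 𝔤] :
    (∀ (α β : LieDerivation ℝ 𝔤 𝔤)
        (hα : Heintze.IsDiagonalizable α) (hβ : Heintze.IsDiagonalizable β),
        Heintze.PositiveEigenvalues α → Heintze.PositiveEigenvalues β →
        ∀ (n m : ℕ)
          (G : Type*) [TopologicalSpace G] [ChartedSpace (EuclideanSpace ℝ (Fin n)) G]
          [Group G] [LieGroup (𝓡 n) ∞ G]
          (H : Type*) [TopologicalSpace H] [ChartedSpace (EuclideanSpace ℝ (Fin m)) H]
          [Group H] [LieGroup (𝓡 m) ∞ H],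
          Heintze.IsHeintzeGroup α n G → Heintze.IsHeintzeGroup β m H →
          Heintze.LieGroupIsomorphic n m G H →
          (Heintze.inducedGrading α hα).Equivalent (Heintze.inducedGrading β hβ)) ∧
    (∀ δ : LieDerivation ℝ 𝔤 𝔤,
        Heintze.IsDiagonalizable δ → Heintze.PositiveEigenvalues δ →
        ∀ Y : 𝔤, ∃ X : 𝔤,
          Heintze.AdExp X * (δ : Module.End ℝ 𝔤) * Heintze.AdExp (-X) =
            (δ : Module.End ℝ 𝔤) - LieAlgebra.ad ℝ 𝔤 Y) := by
  refine ⟨fun α β hα hβ hα' hβ' n m G _ _ _ _ H _ _ _ _ hG hH hGH => ?_,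
    fun δ _ hδ Y => Heintze.exists_AdExp_conj_eq_sub_ad hδ.injective Y⟩
  obtain ⟨eG⟩ := hG.lieAlgebra
  obtain ⟨eH⟩ := hH.lieAlgebra
  obtain ⟨φ, hφ, hψ⟩ := hGH
  have hle : minSmoothness ℝ 3 ≤ ∞ := by
    rw [minSmoothness_of_isRCLikeNormedField]
    exact WithTop.coe_le_coe.mpr le_top
  obtain ⟨d⟩ := Heintze.nonempty_groupLieAlgebra_equiv φ (hφ.of_le hle) (hψ.of_le hle)
  exact Heintze.inducedGrading_equivalent_of_semidirectLine_equiv hα hβ hα'.injective hβ'.injective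
    ((eG.symm.trans d).trans eH)
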